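/- For an open set $U\subset\mathbb R^2$ and $1\le p<\infty$, let $L^1_p(U)$ be the seminormed space of (a.e. classes of) locally integrable, weakly differentiable functions $f:U\to\mathbb R$ whose weak gradient satisfies $\|f\mid L^1_p(U)\|:=\left(\iint_U|\nabla f(x,y)|^p\,dx\,dy\right)^{1/p}<\infty$. Let $\Omega\subset\mathbb R^2$ be a simply connected domain of finite Lebesgue measure $|\Omega|$, let $\mathbb D$ be the open unit disc, and let $\varphi:\mathbb D\to\Omega$ be a conformal mapping (a holomorphic bijection of $\mathbb D$ onto $\Omega$). Then, for every $p\in(2,\infty)$ and every $q\in[1,2]$, the rule $\varphi^*(f)=f\circ\varphi$ defines a bounded linear operator $$\varphi^*:L^1_p(\Omega)\to L^1_q(\mathbb D),\qquad \|\varphi^*\|\le|\Omega|^{\frac{p-2}{2p}}\,\pi^{\frac{2-q}{2q}},$$ that is, $\|f\circ\varphi\mid L^1_q(\mathbb D)\|\le|\Omega|^{\frac{p-2}{2p}}\,\pi^{\frac{2-q}{2q}}\,\|f\mid L^1_p(\Omega)\|$ for all $f\in L^1_p(\Omega)$. -/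

import Mathlib

open MeasureTheory TopologicalSpace
open scoped ENNReal ContDiff

noncomputable section

/-- The locally integrable vector field `g` is the weak gradient on the open set `Ω` of the
locally integrable function `f`: for every test function `ψ ∈ C_c^∞(Ω)` and every direction `v`,
`∫_Ω f ∂_v ψ = - ∫_Ω ⟨g, v⟩ ψ`. The plane is `ℂ`, with its real inner product. -/
structure IsWeakGradient (Ω : Opens ℂ) (f : ℂ → ℝ) (g : ℂ → ℂ) : Prop where
  locallyIntegrableOn : LocallyIntegrableOn f (Ω : Set ℂ)
  locallyIntegrableOn_grad : LocallyIntegrableOn g (Ω : Set ℂ)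
  integral_fderiv : ∀ ψ : ℂ → ℝ, ContDiff ℝ ∞ ψ → HasCompactSupport ψ → tsupport ψ ⊆ Ω →
    ∀ v : ℂ, ∫ z in (Ω : Set ℂ), f z * fderiv ℝ ψ z v =
      -∫ z in (Ω : Set ℂ), inner ℝ (g z) v * ψ z

namespace IsWeakGradient

variable {Ω : Opens ℂ} {f f₁ f₂ : ℂ → ℝ} {g g₁ g₂ : ℂ → ℂ}

theorem congr (h : IsWeakGradient Ω f₁ g) (hf : f₁ =ᵐ[volume.restrict Ω] f₂) :
    IsWeakGradient Ω f₂ g where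
  locallyIntegrableOn := h.locallyIntegrableOn.congr hf
  locallyIntegrableOn_grad := h.locallyIntegrableOn_grad
  integral_fderiv ψ h1 h2 h3 v := by
    rw [← h.integral_fderiv ψ h1 h2 h3 v]
    refine integral_congr_ae ?_
    filter_upwards [hf] with z hz
    rw [hz]

theorem zero : IsWeakGradient Ω 0 0 where
  locallyIntegrableOn := locallyIntegrableOn_zero
  locallyIntegrableOn_grad := locallyIntegrableOn_zero
  integral_fderiv ψ _ _ _ v := by simp

/-- A locally integrable function times a continuous function with compact support in `Ω` is
integrable. -/
theorem integrable_mul {h u : ℂ → ℝ} (hh : LocallyIntegrableOn h (Ω : Set ℂ))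
    (hu : Continuous u) (hc : HasCompactSupport u) (hs : tsupport u ⊆ Ω) :
    Integrable (fun z => h z * u z) := by
  have hK : IntegrableOn h (tsupport u) := hh.integrableOn_compact_subset hs hc
  have : IntegrableOn (fun z => h z * u z) (tsupport u) :=
    hK.mul_continuousOn hu.continuousOn hc
  refine (integrableOn_iff_integrable_of_support_subset ?_).1 this
  intro z hz
  refine subset_tsupport _ ?_
  intro h0
  exact hz (by simp [h0])

theorem locallyIntegrableOn_inner (hg : LocallyIntegrableOn g (Ω : Set ℂ)) (v : ℂ) :
    LocallyIntegrableOn (fun z => inner ℝ (g z) v) (Ω : Set ℂ) := by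
  have : (fun z => inner ℝ (g z) v) = fun z => (innerSL ℝ v) (g z) := by
    ext z
    rw [innerSL_apply_apply, real_inner_comm]
  rw [this]
  intro z hz
  obtain ⟨s, hs, h⟩ := hg z hz
  exact ⟨s, hs, (innerSL ℝ v).integrable_comp h⟩

theorem integrable_left (h : IsWeakGradient Ω f g) {ψ : ℂ → ℝ} (h1 : ContDiff ℝ ∞ ψ)
    (h2 : HasCompactSupport ψ) (h3 : tsupport ψ ⊆ Ω) (v : ℂ) :
    Integrable (fun z => f z * fderiv ℝ ψ z v) (volume.restrict Ω) := by
  have hsub : tsupport (fun z => fderiv ℝ ψ z v) ⊆ tsupport ψ :=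
    closure_minimal (fun z hz => by
      by_contra hz'
      apply hz
      have : fderiv ℝ ψ z = 0 := by
        by_contra hne
        exact hz' (support_fderiv_subset ℝ hne)
      simp [this]) (isClosed_tsupport _)
  exact (integrable_mul h.locallyIntegrableOn
    ((h1.continuous_fderiv (by simp)).clm_apply continuous_const)
    (h2.of_isClosed_subset (isClosed_tsupport _) hsub) (hsub.trans h3)).restrict

theorem integrable_right (h : IsWeakGradient Ω f g) {ψ : ℂ → ℝ} (h1 : ContDiff ℝ ∞ ψ)
    (h2 : HasCompactSupport ψ) (h3 : tsupport ψ ⊆ Ω) (v : ℂ) :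
    Integrable (fun z => inner ℝ (g z) v * ψ z) (volume.restrict Ω) :=
  (integrable_mul (locallyIntegrableOn_inner h.locallyIntegrableOn_grad v)
    h1.continuous h2 h3).restrict

theorem add (h : IsWeakGradient Ω f₁ g₁) (h' : IsWeakGradient Ω f₂ g₂) :
    IsWeakGradient Ω (f₁ + f₂) (g₁ + g₂) where
  locallyIntegrableOn := h.locallyIntegrableOn.add h'.locallyIntegrableOn
  locallyIntegrableOn_grad := h.locallyIntegrableOn_grad.add h'.locallyIntegrableOn_grad
  integral_fderiv ψ h1 h2 h3 v := by
    simp only [Pi.add_apply, inner_add_left, add_mul]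
    rw [integral_add (h.integrable_left h1 h2 h3 v) (h'.integrable_left h1 h2 h3 v),
      integral_add (h.integrable_right h1 h2 h3 v) (h'.integrable_right h1 h2 h3 v),
      h.integral_fderiv ψ h1 h2 h3 v, h'.integral_fderiv ψ h1 h2 h3 v]
    ring

theorem smul (c : ℝ) (h : IsWeakGradient Ω f g) : IsWeakGradient Ω (c • f) (c • g) where
  locallyIntegrableOn := h.locallyIntegrableOn.smul c
  locallyIntegrableOn_grad := h.locallyIntegrableOn_grad.smul c
  integral_fderiv ψ h1 h2 h3 v := by
    simp only [Pi.smul_apply, smul_eq_mul, real_inner_smul_left, mul_assoc]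
    rw [integral_const_mul, integral_const_mul, h.integral_fderiv ψ h1 h2 h3 v]
    ring

/-- The weak gradient is unique almost everywhere on `Ω`. -/
theorem unique (h : IsWeakGradient Ω f g₁) (h' : IsWeakGradient Ω f g₂) :
    g₁ =ᵐ[volume.restrict Ω] g₂ := by
  have key : ∀ v : ℂ, ∀ᵐ z, z ∈ (Ω : Set ℂ) → inner ℝ (g₁ z - g₂ z) v = 0 := by
    intro v
    refine Ω.isOpen.ae_eq_zero_of_integral_contDiff_smul_eq_zero
      (locallyIntegrableOn_inner
        (h.locallyIntegrableOn_grad.sub h'.locallyIntegrableOn_grad) v) ?_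
    intro ψ h1 h2 h3
    have e : ∫ z, ψ z • inner ℝ (g₁ z - g₂ z) v
        = ∫ z in (Ω : Set ℂ), ψ z • inner ℝ (g₁ z - g₂ z) v := by
      refine (setIntegral_eq_integral_of_forall_compl_eq_zero fun z hz => ?_).symm
      rw [image_eq_zero_of_notMem_tsupport fun hz' => hz (h3 hz'), zero_smul]
    have e1 := h.integral_fderiv ψ h1 h2 h3 v
    have e2 := h'.integral_fderiv ψ h1 h2 h3 v
    calc ∫ z, ψ z • inner ℝ ((g₁ - g₂) z) v
        = ∫ z in (Ω : Set ℂ), (inner ℝ (g₁ z) v * ψ z - inner ℝ (g₂ z) v * ψ z) := by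
          simp only [Pi.sub_apply]
          rw [e]
          congr 1
          ext z
          rw [inner_sub_left, smul_eq_mul]
          ring
      _ = 0 := by
          rw [integral_sub (h.integrable_right h1 h2 h3 v) (h'.integrable_right h1 h2 h3 v)]
          linarith
  refine (ae_restrict_iff' Ω.isOpen.measurableSet).2 ?_
  filter_upwards [key 1, key Complex.I] with z hz1 hzI hz
  have a := hz1 hz
  have b := hzI hz
  rw [Complex.inner] at a b
  apply sub_eq_zero.1
  apply Complex.ext
  · simpa using a
  · have b' : -(g₂ z).im + (g₁ z).im = 0 := by simpa using b
    simp only [Complex.sub_im, Complex.zero_im]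
    linarith

end IsWeakGradient

/-- The homogeneous Sobolev space `L¹_p(Ω)`: (a.e. classes of) locally integrable, weakly
differentiable functions `f : Ω → ℝ` whose weak gradient is in `L_p(Ω)`. -/
def HomSobolev (Ω : Opens ℂ) (p : ℝ) : Submodule ℝ (ℂ →ₘ[volume.restrict (Ω : Set ℂ)] ℝ) where
  carrier := {f | ∃ g : ℂ → ℂ, IsWeakGradient Ω f g ∧
    MemLp g (ENNReal.ofReal p) (volume.restrict (Ω : Set ℂ))}
  zero_mem' := ⟨0, IsWeakGradient.zero.congr AEEqFun.coeFn_zero.symm, MemLp.zero⟩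
  add_mem' := by
    rintro f₁ f₂ ⟨g₁, h₁, m₁⟩ ⟨g₂, h₂, m₂⟩
    exact ⟨g₁ + g₂, (h₁.add h₂).congr (AEEqFun.coeFn_add f₁ f₂).symm, m₁.add m₂⟩
  smul_mem' := by
    rintro c f ⟨g, h, m⟩
    exact ⟨c • g, (h.smul c).congr (AEEqFun.coeFn_smul c f).symm, m.const_smul c⟩

namespace HomSobolev

variable {Ω : Opens ℂ} {p : ℝ}

/-- The weak gradient `∇f` of `f ∈ L¹_p(Ω)`. -/
def grad (f : HomSobolev Ω p) : ℂ → ℂ := f.2.choose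

theorem isWeakGradient_grad (f : HomSobolev Ω p) :
    IsWeakGradient Ω (f : ℂ →ₘ[volume.restrict (Ω : Set ℂ)] ℝ) (grad f) :=
  f.2.choose_spec.1

theorem memLp_grad (f : HomSobolev Ω p) :
    MemLp (grad f) (ENNReal.ofReal p) (volume.restrict (Ω : Set ℂ)) :=
  f.2.choose_spec.2

theorem grad_add (f₁ f₂ : HomSobolev Ω p) :
    (grad (f₁ + f₂)) =ᵐ[volume.restrict (Ω : Set ℂ)] (grad f₁) + (grad f₂) :=
  (isWeakGradient_grad (f₁ + f₂)).unique
    (((isWeakGradient_grad f₁).add (isWeakGradient_grad f₂)).congr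
      (AEEqFun.coeFn_add (f₁ : ℂ →ₘ[volume.restrict (Ω : Set ℂ)] ℝ) f₂).symm)

theorem grad_smul (c : ℝ) (f : HomSobolev Ω p) :
    (grad (c • f)) =ᵐ[volume.restrict (Ω : Set ℂ)] c • (grad f) :=
  (isWeakGradient_grad (c • f)).unique
    (((isWeakGradient_grad f).smul c).congr
      (AEEqFun.coeFn_smul c (f : ℂ →ₘ[volume.restrict (Ω : Set ℂ)] ℝ)).symm)

/-- The seminorm `‖f | L¹_p(Ω)‖ = (∫_Ω |∇f|^p)^(1/p)`. -/
def gradNorm (f : HomSobolev Ω p) : ℝ := (∫ z in (Ω : Set ℂ), ‖(grad f) z‖ ^ p) ^ (1 / p)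

theorem gradNorm_eq (hp : 1 ≤ p) (f : HomSobolev Ω p) :
    (gradNorm f) = (eLpNorm (grad f) (ENNReal.ofReal p) (volume.restrict (Ω : Set ℂ))).toReal := by
  have hp0 : 0 < p := by linarith
  rw [(memLp_grad f).eLpNorm_eq_integral_rpow_norm (by simpa using hp0) ENNReal.ofReal_ne_top,
    ENNReal.toReal_ofReal hp0.le, ENNReal.toReal_ofReal (by positivity), gradNorm, one_div]

theorem gradNorm_add_le (hp : 1 ≤ p) (f₁ f₂ : HomSobolev Ω p) :
    (gradNorm (f₁ + f₂)) ≤ (gradNorm f₁) + (gradNorm f₂) := by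
  rw [gradNorm_eq hp, gradNorm_eq hp, gradNorm_eq hp, eLpNorm_congr_ae (grad_add f₁ f₂),
    ← ENNReal.toReal_add (memLp_grad f₁).eLpNorm_ne_top (memLp_grad f₂).eLpNorm_ne_top]
  refine ENNReal.toReal_mono (ENNReal.add_ne_top.2
    ⟨(memLp_grad f₁).eLpNorm_ne_top, (memLp_grad f₂).eLpNorm_ne_top⟩) ?_
  exact eLpNorm_add_le (memLp_grad f₁).aestronglyMeasurable (memLp_grad f₂).aestronglyMeasurable
    (by simpa using hp)

theorem gradNorm_smul (hp : 1 ≤ p) (c : ℝ) (f : HomSobolev Ω p) :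
    (gradNorm (c • f)) = |c| * (gradNorm f) := by
  rw [gradNorm_eq hp, gradNorm_eq hp, eLpNorm_congr_ae (grad_smul c f), eLpNorm_const_smul,
    ENNReal.toReal_mul]
  simp

/-- `L¹_p(Ω)`, `1 ≤ p < ∞`, as a seminormed space. -/
instance [hp : Fact (1 ≤ p)] : SeminormedAddCommGroup (HomSobolev Ω p) :=
  AddGroupSeminorm.toSeminormedAddCommGroup
    { toFun := gradNorm
      map_zero' := by
        have := gradNorm_smul hp.out 0 (0 : HomSobolev Ω p)
        simpa using this
      add_le' := gradNorm_add_le hp.out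
      neg' := fun f => by
        have := gradNorm_smul hp.out (-1) f
        rw [abs_neg, abs_one, one_mul] at this
        rwa [show (-1 : ℝ) • f = -f from neg_one_smul ℝ f] at this }

theorem norm_def [Fact (1 ≤ p)] (f : HomSobolev Ω p) :
    ‖f‖ = (∫ z in (Ω : Set ℂ), ‖(grad f) z‖ ^ p) ^ (1 / p) := rfl

instance [hp : Fact (1 ≤ p)] : NormedSpace ℝ (HomSobolev Ω p) where
  norm_smul_le c f := (gradNorm_smul hp.out c f).le

end HomSobolev

/-- The open unit disc `𝔻` in the plane. -/
def unitDisc : Opens ℂ := ⟨Metric.ball 0 1, Metric.isOpen_ball⟩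

/-- `φ` is a conformal mapping of the open set `U` onto the open set `V`: a holomorphic bijection
(so that automatically `|φ'|² = J_φ > 0` on `U`). Values outside `U` are irrelevant. -/
structure IsConformalMapping (φ : ℂ → ℂ) (U V : Opens ℂ) : Prop where
  differentiableOn : DifferentiableOn ℂ φ U
  bijOn : Set.BijOn φ U V

end

/-! The engine is the conformal invariance of the Dirichlet integral. The gradient of `f ∘ φ` is
`conj φ' · (∇f ∘ φ)`, and `|φ'|²` is the real Jacobian of `φ`, so the `L²` norms of the two
gradients agree (`eLpNorm_two_grad_comp`). Hölder on `Ω` passes from exponent `p` down to 2, Hölder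
on the disc from 2 down to `q`; the measures of the two domains give the two constants.

The work lies in the chain rule for weak gradients (`comp_isConformalMapping`). A test function `ψ`
on `U` is carried to `ψ ∘ φ⁻¹` on `V`, and a constant direction on `U` becomes the conjugate of a
holomorphic field on `V`. Such a field is divergence free by the Cauchy–Riemann equations, so the
weak gradient can be tested against it (`integral_fderiv_conj`). This needs `φ⁻¹` holomorphic and
`φ' ≠ 0`, both derived from bijectivity. -/

open Filter Topology

/-! ### Injective holomorphic maps: holomorphic inverse and nonvanishing derivative. -/

namespace IsConformalMapping

variable {φ : ℂ → ℂ} {U V : Opens ℂ}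

theorem analyticAt (hφ : IsConformalMapping φ U V) {z : ℂ} (hz : z ∈ U) : AnalyticAt ℂ φ z :=
  hφ.differentiableOn.analyticAt (U.isOpen.mem_nhds hz)

theorem not_eventually_const (hφ : IsConformalMapping φ U V) {z : ℂ} (hz : z ∈ U) :
    ¬ ∀ᶠ y in 𝓝 z, φ y = φ z := by
  intro h
  have h' : ∀ᶠ y in 𝓝[≠] z, y = z := by
    filter_upwards [(h.and (U.isOpen.mem_nhds hz)).filter_mono nhdsWithin_le_nhds] with y hy
    exact hφ.bijOn.injOn hy.2 hz hy.1
  obtain ⟨y, hy, hy'⟩ := (h'.and self_mem_nhdsWithin).exists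
  exact hy' hy

theorem nhds_le_map (hφ : IsConformalMapping φ U V) {z : ℂ} (hz : z ∈ U) :
    𝓝 (φ z) ≤ map φ (𝓝 z) :=
  (hφ.analyticAt hz).eventually_constant_or_nhds_le_map_nhds.resolve_left
    (hφ.not_eventually_const hz)

theorem eventually_deriv_ne_zero (hφ : IsConformalMapping φ U V) {z : ℂ} (hz : z ∈ U) :
    ∀ᶠ y in 𝓝[≠] z, deriv φ y ≠ 0 := by
  refine (hφ.analyticAt hz).deriv.eventually_eq_zero_or_eventually_ne_zero.resolve_left fun h => ?_
  apply hφ.not_eventually_const hz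
  obtain ⟨r, hr, hball⟩ := Metric.eventually_nhds_iff_ball.1 (h.and (U.isOpen.mem_nhds hz))
  filter_upwards [Metric.ball_mem_nhds z hr] with y hy
  exact Metric.isOpen_ball.is_const_of_deriv_eq_zero (convex_ball z r).isPreconnected
    (hφ.differentiableOn.mono fun w hw => (hball w hw).2) (fun w hw => (hball w hw).1) hy
    (Metric.mem_ball_self hr)

theorem leftInvOn (hφ : IsConformalMapping φ U V) :
    Set.LeftInvOn (Function.invFunOn φ U) φ U := hφ.bijOn.injOn.leftInvOn_invFunOn

theorem rightInvOn (hφ : IsConformalMapping φ U V) :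
    Set.RightInvOn (Function.invFunOn φ U) φ V := hφ.bijOn.surjOn.rightInvOn_invFunOn

theorem bijOn_invFunOn (hφ : IsConformalMapping φ U V) :
    Set.BijOn (Function.invFunOn φ U) V U :=
  Set.InvOn.bijOn ⟨hφ.rightInvOn, hφ.leftInvOn⟩ hφ.bijOn.surjOn.mapsTo_invFunOn hφ.bijOn.mapsTo

/-- This is the open mapping theorem, in the form `nhds_le_map`. -/
theorem continuousAt_invFunOn (hφ : IsConformalMapping φ U V) {z : ℂ} (hz : z ∈ U) :
    ContinuousAt (Function.invFunOn φ U) (φ z) := by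
  intro s hs
  rw [hφ.leftInvOn hz] at hs
  have h := hφ.nhds_le_map hz (image_mem_map (inter_mem hs (U.isOpen.mem_nhds hz)))
  rw [mem_map]
  refine mem_of_superset h ?_
  rintro _ ⟨y, ⟨hys, hyU⟩, rfl⟩
  simpa [hφ.leftInvOn hyU] using hys

theorem hasDerivAt_invFunOn_of_deriv_ne_zero (hφ : IsConformalMapping φ U V) {z : ℂ} (hz : z ∈ U)
    (h : deriv φ z ≠ 0) : HasDerivAt (Function.invFunOn φ U) (deriv φ z)⁻¹ (φ z) := by
  refine HasDerivAt.of_local_left_inverse (f := φ) (hφ.continuousAt_invFunOn hz) ?_ h ?_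
  · rw [hφ.leftInvOn hz]
    exact (hφ.analyticAt hz).differentiableAt.hasDerivAt
  · filter_upwards [V.isOpen.mem_nhds (hφ.bijOn.mapsTo hz)] with w hw
    exact hφ.rightInvOn hw

/-- Zeros of `φ'` are isolated, so the inverse is differentiable on a punctured neighbourhood of `φ
z`; being continuous at `φ z`, it extends holomorphically by removability of the singularity. -/
theorem differentiableAt_invFunOn (hφ : IsConformalMapping φ U V) {z : ℂ} (hz : z ∈ U) :
    DifferentiableAt ℂ (Function.invFunOn φ U) (φ z) := by
  refine (Complex.analyticAt_of_differentiable_on_punctured_nhds_of_continuousAt ?_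
    (hφ.continuousAt_invFunOn hz)).differentiableAt
  have hne := eventually_nhdsWithin_iff.1 (hφ.eventually_deriv_ne_zero hz)
  have hc : Tendsto (Function.invFunOn φ U) (𝓝 (φ z)) (𝓝 z) := by
    simpa [ContinuousAt, hφ.leftInvOn hz] using hφ.continuousAt_invFunOn hz
  rw [eventually_nhdsWithin_iff]
  filter_upwards [hc hne, V.isOpen.mem_nhds (hφ.bijOn.mapsTo hz)] with w hw hwV hwz
  have hwU := hφ.bijOn_invFunOn.mapsTo hwV
  have h := hφ.hasDerivAt_invFunOn_of_deriv_ne_zero hwU (hw fun h => hwz ?_)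
  · rw [hφ.rightInvOn hwV] at h
    exact h.differentiableAt
  · rw [Set.mem_singleton_iff] at h ⊢
    rw [← h, hφ.rightInvOn hwV]

/-- Since the inverse is differentiable, the chain rule for `φ⁻¹ ∘ φ = id` would read `0 = 1` at a
zero of `φ'`. -/
theorem deriv_ne_zero (hφ : IsConformalMapping φ U V) {z : ℂ} (hz : z ∈ U) : deriv φ z ≠ 0 := by
  intro h0
  have h1 := (hφ.differentiableAt_invFunOn hz).hasDerivAt.comp z
    (hφ.analyticAt hz).differentiableAt.hasDerivAt
  have h2 : HasDerivAt (Function.invFunOn φ U ∘ φ) 1 z := by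
    refine (hasDerivAt_id z).congr_of_eventuallyEq ?_
    filter_upwards [U.isOpen.mem_nhds hz] with y hy using hφ.leftInvOn hy
  simpa [h0] using h1.unique h2

theorem hasDerivAt_invFunOn (hφ : IsConformalMapping φ U V) {z : ℂ} (hz : z ∈ U) :
    HasDerivAt (Function.invFunOn φ U) (deriv φ z)⁻¹ (φ z) :=
  hφ.hasDerivAt_invFunOn_of_deriv_ne_zero hz (hφ.deriv_ne_zero hz)

theorem symm (hφ : IsConformalMapping φ U V) :
    IsConformalMapping (Function.invFunOn φ U) V U where
  differentiableOn w hw := by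
    have h := hφ.differentiableAt_invFunOn (hφ.bijOn_invFunOn.mapsTo hw)
    rw [hφ.rightInvOn hw] at h
    exact h.differentiableWithinAt
  bijOn := hφ.bijOn_invFunOn

/-! ### Change of variables -/

theorem hasFDerivAt (hφ : IsConformalMapping φ U V) {z : ℂ} (hz : z ∈ U) :
    HasFDerivAt φ (deriv φ z • (1 : ℂ →L[ℝ] ℂ)) z :=
  (hφ.analyticAt hz).differentiableAt.hasDerivAt.complexToReal_fderiv

theorem _root_.Complex.abs_det_smul_one (a : ℂ) :
    |(a • (1 : ℂ →L[ℝ] ℂ)).det| = ‖a‖ ^ 2 := by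
  have : (a • (1 : ℂ →L[ℝ] ℂ)).det = Algebra.norm ℝ a := rfl
  rw [this, Algebra.norm_complex_eq]
  simp [Complex.normSq_eq_norm_sq]

theorem integrableOn_image_iff (hφ : IsConformalMapping φ U V) {E : Type*} [NormedAddCommGroup E]
    [NormedSpace ℝ E] {s : Set ℂ} (hs : MeasurableSet s) (hsU : s ⊆ U) (F : ℂ → E) :
    IntegrableOn F (φ '' s) ↔ IntegrableOn (fun z => ‖deriv φ z‖ ^ 2 • F (φ z)) s := by
  simpa only [Complex.abs_det_smul_one] using
    integrableOn_image_iff_integrableOn_abs_det_fderiv_smul volume hs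
      (fun z hz => (hφ.hasFDerivAt (hsU hz)).hasFDerivWithinAt) (hφ.bijOn.injOn.mono hsU) F

theorem setIntegral_eq (hφ : IsConformalMapping φ U V) {E : Type*} [NormedAddCommGroup E]
    [NormedSpace ℝ E] (F : ℂ → E) :
    ∫ w in (V : Set ℂ), F w = ∫ z in (U : Set ℂ), ‖deriv φ z‖ ^ 2 • F (φ z) := by
  rw [← hφ.bijOn.image_eq]
  simpa only [Complex.abs_det_smul_one] using
    integral_image_eq_integral_abs_det_fderiv_smul volume U.isOpen.measurableSet
      (fun z hz => (hφ.hasFDerivAt hz).hasFDerivWithinAt) hφ.bijOn.injOn F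

theorem setLIntegral_eq (hφ : IsConformalMapping φ U V) (F : ℂ → ℝ≥0∞) :
    ∫⁻ w in (V : Set ℂ), F w = ∫⁻ z in (U : Set ℂ), ‖deriv φ z‖ₑ ^ 2 * F (φ z) := by
  rw [← hφ.bijOn.image_eq]
  simpa only [Complex.abs_det_smul_one, ENNReal.ofReal_pow (norm_nonneg _), ofReal_norm] using
    lintegral_image_eq_lintegral_abs_det_fderiv_mul volume U.isOpen.measurableSet
      (fun z hz => (hφ.hasFDerivAt hz).hasFDerivWithinAt) hφ.bijOn.injOn F

/-- Makes composition well defined on a.e. classes: the preimage of a null set is its image under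
the differentiable inverse. The indicator is there because `φ` is arbitrary, perhaps non-measurable,
off `U`. -/
theorem quasiMeasurePreserving (hφ : IsConformalMapping φ U V) :
    Measure.QuasiMeasurePreserving ((U : Set ℂ).indicator φ)
      (volume.restrict (U : Set ℂ)) (volume.restrict (V : Set ℂ)) := by
  classical
  have hm : Measurable ((U : Set ℂ).indicator φ) := by
    have : ((U : Set ℂ).indicator φ) = (U : Set ℂ).piecewise φ 0 := by
      rw [Set.piecewise_eq_indicator]
    rw [this]
    exact hφ.differentiableOn.continuousOn.measurable_piecewise continuousOn_const
      U.isOpen.measurableSet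
  refine ⟨hm, Measure.AbsolutelyContinuous.mk fun s hs h0 => ?_⟩
  rw [Measure.restrict_apply hs] at h0
  rw [Measure.map_apply hm hs, Measure.restrict_apply (hm hs)]
  have h := addHaar_image_eq_zero_of_differentiableOn_of_addHaar_eq_zero
    (f := Function.invFunOn φ U) (s := s ∩ V) volume
    (fun w hw => ((hφ.symm.hasFDerivAt hw.2).differentiableAt).differentiableWithinAt) h0
  refine measure_mono_null ?_ h
  rintro z ⟨hz, hzU⟩
  have hz' : φ z ∈ s := by simpa [Set.indicator_of_mem hzU] using hz
  exact ⟨φ z, ⟨hz', hφ.bijOn.mapsTo hzU⟩, hφ.leftInvOn hzU⟩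

theorem indicator_ae_eq (φ : ℂ → ℂ) (U : Opens ℂ) :
    (U : Set ℂ).indicator φ =ᵐ[volume.restrict (U : Set ℂ)] φ :=
  indicator_ae_eq_restrict U.isOpen.measurableSet

theorem continuousOn_deriv (hφ : IsConformalMapping φ U V) :
    ContinuousOn (deriv φ) U :=
  fun _ hz => (hφ.analyticAt hz).deriv.continuousAt.continuousWithinAt

/-- On a compact set the Jacobian `|φ'|²` has a continuous inverse, so it can be divided out of the
change of variables. -/
theorem locallyIntegrableOn_comp (hφ : IsConformalMapping φ U V) {E : Type*}
    [NormedAddCommGroup E] [NormedSpace ℝ E] {F : ℂ → E}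
    (hF : LocallyIntegrableOn F (V : Set ℂ)) :
    LocallyIntegrableOn (F ∘ φ) (U : Set ℂ) := by
  rw [locallyIntegrableOn_iff U.isOpen.isLocallyClosed]
  intro K hKU hK
  have hFK : IntegrableOn F (φ '' K) := hF.integrableOn_compact_subset
    (hφ.bijOn.mapsTo.mono_left hKU).image_subset
    (hK.image_of_continuousOn (hφ.differentiableOn.continuousOn.mono hKU))
  have hne : ∀ z ∈ K, ‖deriv φ z‖ ^ 2 ≠ 0 := fun z hz =>
    pow_ne_zero 2 (norm_ne_zero_iff.2 (hφ.deriv_ne_zero (hKU hz)))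
  refine (((hφ.integrableOn_image_iff hK.measurableSet hKU F).1 hFK).continuousOn_smul
    (((hφ.continuousOn_deriv.mono hKU).norm.pow 2).inv₀ hne) hK).congr_fun
    (fun z hz => ?_) hK.measurableSet
  exact inv_smul_smul₀ (hne z hz) _

end IsConformalMapping

/-! ### Weak gradients under a conformal change of variables. -/

theorem ContDiffOn.contDiff_of_eq_zero_off {V : Opens ℂ} {F : ℂ → ℝ} {K : Set ℂ}
    (hF : ContDiffOn ℝ ∞ F V) (hK : IsClosed K) (hKV : K ⊆ V) (h0 : ∀ w ∉ K, F w = 0) :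
    ContDiff ℝ ∞ F := by
  rw [contDiff_iff_contDiffAt]
  intro w
  by_cases hw : w ∈ V
  · exact hF.contDiffAt (V.isOpen.mem_nhds hw)
  · refine (contDiffAt_const (c := (0 : ℝ))).congr_of_eventuallyEq ?_
    filter_upwards [hK.isOpen_compl.mem_nhds fun h => hw (hKV h)] with y hy using h0 y hy

namespace IsWeakGradient

variable {φ : ℂ → ℂ} {U V : Opens ℂ} {f : ℂ → ℝ} {g : ℂ → ℂ}

/-- For `h` holomorphic the vector field `conj h` is divergence free, so that the weak gradient
may be tested against it. -/
theorem integral_fderiv_conj (hfg : IsWeakGradient V f g) {h : ℂ → ℂ}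
    (hh : DifferentiableOn ℂ h V) {ψ : ℂ → ℝ} (h1 : ContDiff ℝ ∞ ψ)
    (h2 : HasCompactSupport ψ) (h3 : tsupport ψ ⊆ V) :
    ∫ w in (V : Set ℂ), f w * fderiv ℝ ψ w (starRingEnd ℂ (h w)) =
      -∫ w in (V : Set ℂ), inner ℝ (g w) (starRingEnd ℂ (h w)) * ψ w := by
  have hsm : ContDiffOn ℝ ∞ h V := ((hh.contDiffOn V.isOpen).restrict_scalars ℝ)
  have hA : ContDiffOn ℝ ∞ (fun w => (h w).re) V := Complex.reCLM.contDiff.comp_contDiffOn hsm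
  have hB : ContDiffOn ℝ ∞ (fun w => -(h w).im) V :=
    (Complex.imCLM.contDiff.comp_contDiffOn hsm).neg
  have test : ∀ a : ℂ → ℝ, ContDiffOn ℝ ∞ a V →
      ContDiff ℝ ∞ (fun w => a w * ψ w) ∧ HasCompactSupport (fun w => a w * ψ w) ∧
        tsupport (fun w => a w * ψ w) ⊆ V := by
    intro a ha
    refine ⟨(ha.mul h1.contDiffOn).contDiff_of_eq_zero_off (isClosed_tsupport ψ) h3 fun w hw => ?_,
      h2.mul_left, (tsupport_mul_subset_right).trans h3⟩
    simp [image_eq_zero_of_notMem_tsupport hw]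
  obtain ⟨a1, a2, a3⟩ := test _ hA
  obtain ⟨b1, b2, b3⟩ := test _ hB
  have ea := hfg.integral_fderiv _ a1 a2 a3 1
  have eb := hfg.integral_fderiv _ b1 b2 b3 Complex.I
  -- The product rule produces the extra term `(∂ₓ Re h - ∂_y Im h) ψ`, which vanishes by
  -- Cauchy–Riemann.
  have key : ∀ w ∈ (V : Set ℂ), f w * fderiv ℝ ψ w (starRingEnd ℂ (h w)) =
      f w * fderiv ℝ (fun w => (h w).re * ψ w) w 1 +
        f w * fderiv ℝ (fun w => -(h w).im * ψ w) w Complex.I := by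
    intro w hw
    have dh : HasFDerivAt h (deriv h w • (1 : ℂ →L[ℝ] ℂ)) w :=
      (hh.differentiableAt (V.isOpen.mem_nhds hw)).hasDerivAt.complexToReal_fderiv
    have dψ := (h1.differentiable (by simp) w).hasFDerivAt
    have dre : HasFDerivAt (fun w => (h w).re) (Complex.reCLM ∘L (deriv h w • (1 : ℂ →L[ℝ] ℂ))) w :=
      Complex.reCLM.hasFDerivAt.comp w dh
    have dim : HasFDerivAt (fun w => (h w).im) (Complex.imCLM ∘L (deriv h w • (1 : ℂ →L[ℝ] ℂ))) w :=
      Complex.imCLM.hasFDerivAt.comp w dh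
    have ec : starRingEnd ℂ (h w) = (h w).re • (1 : ℂ) + (-(h w).im) • Complex.I := by
      apply Complex.ext <;> simp
    have da := (dre.fun_mul dψ).fderiv
    have db := (dim.fun_neg.fun_mul dψ).fderiv
    rw [da, db, ec, map_add, map_smul, map_smul]
    simp
    ring
  rw [setIntegral_congr_fun V.isOpen.measurableSet key,
    integral_add (hfg.integrable_left a1 a2 a3 1) (hfg.integrable_left b1 b2 b3 Complex.I), ea, eb,
    ← neg_add, ← integral_add (hfg.integrable_right a1 a2 a3 1)
      (hfg.integrable_right b1 b2 b3 Complex.I)]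
  congr 2
  ext w
  simp [Complex.inner]
  ring

/-- Chain rule for the weak gradient under a conformal change of variables. -/
theorem comp_isConformalMapping (hfg : IsWeakGradient V f g) (hφ : IsConformalMapping φ U V) :
    IsWeakGradient U (f ∘ φ) (fun z => starRingEnd ℂ (deriv φ z) * g (φ z)) where
  locallyIntegrableOn := hφ.locallyIntegrableOn_comp hfg.locallyIntegrableOn
  locallyIntegrableOn_grad := by
    have := hφ.locallyIntegrableOn_comp hfg.locallyIntegrableOn_grad
    rw [locallyIntegrableOn_iff U.isOpen.isLocallyClosed] at this ⊢
    intro K hKU hK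
    exact (this K hKU hK).continuousOn_mul
      (Complex.continuous_conj.comp_continuousOn (hφ.continuousOn_deriv.mono hKU)) hK
  integral_fderiv ψ h1 h2 h3 v := by
    set χ := Function.invFunOn φ U with hχ
    have hsymm : IsConformalMapping χ V U := hφ.symm
    have hleft : Set.LeftInvOn χ φ U := hφ.leftInvOn
    have hright : Set.RightInvOn χ φ V := hφ.rightInvOn
    -- Cut off outside `V`, where `χ` takes junk values.
    set Ψ : ℂ → ℝ := (V : Set ℂ).indicator (ψ ∘ χ) with hΨ
    have hK : IsCompact (φ '' tsupport ψ) :=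
      IsCompact.image_of_continuousOn h2 (hφ.differentiableOn.continuousOn.mono h3)
    have hKV : φ '' tsupport ψ ⊆ V := (hφ.bijOn.mapsTo.mono_left h3).image_subset
    have hΨ0 : ∀ w ∉ φ '' tsupport ψ, Ψ w = 0 := by
      intro w hw
      by_cases hwV : w ∈ (V : Set ℂ)
      · rw [hΨ, Set.indicator_of_mem hwV, Function.comp_apply]
        refine image_eq_zero_of_notMem_tsupport fun h => hw ⟨χ w, h, hright hwV⟩
      · rw [hΨ, Set.indicator_of_notMem hwV]
    have hΨφ : ∀ z ∈ (U : Set ℂ), Ψ (φ z) = ψ z := by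
      intro z hz
      rw [hΨ, Set.indicator_of_mem (hφ.bijOn.mapsTo hz), Function.comp_apply, hleft hz]
    have c1 : ContDiff ℝ ∞ Ψ := by
      have : ContDiffOn ℝ ∞ Ψ V :=
        (h1.comp_contDiffOn ((hsymm.differentiableOn.contDiffOn V.isOpen).restrict_scalars ℝ)).congr
          fun w hw => Set.indicator_of_mem hw _
      exact this.contDiff_of_eq_zero_off hK.isClosed hKV hΨ0
    have hsupp : tsupport Ψ ⊆ φ '' tsupport ψ :=
      closure_minimal (fun w hw => by_contra fun h => hw (hΨ0 w h)) hK.isClosed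
    have c2 : HasCompactSupport Ψ := hK.of_isClosed_subset (isClosed_tsupport Ψ) hsupp
    -- The conjugate of this function is the field that, weighted by the Jacobian, pulls back to `φ'
    -- v`, the image of the direction `v`; see `hvec`.
    have hh : DifferentiableOn ℂ (fun w => deriv χ w * starRingEnd ℂ v) V :=
      (hsymm.differentiableOn.deriv V.isOpen).mul_const _
    have key := hfg.integral_fderiv_conj hh c1 c2 (hsupp.trans hKV)
    rw [hφ.setIntegral_eq, hφ.setIntegral_eq] at key
    have hvec : ∀ z ∈ (U : Set ℂ), ‖deriv φ z‖ ^ 2 •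
        starRingEnd ℂ (deriv χ (φ z) * starRingEnd ℂ v) = deriv φ z * v := by
      intro z hz
      have hne : starRingEnd ℂ (deriv φ z) ≠ 0 := by simpa using hφ.deriv_ne_zero hz
      rw [(hφ.hasDerivAt_invFunOn hz).deriv, Complex.real_smul, Complex.ofReal_pow,
        ← Complex.mul_conj', map_mul, map_inv₀, Complex.conj_conj]
      field_simp
    rw [setIntegral_congr_fun U.isOpen.measurableSet (fun z hz => ?_), key]
    · congr 1
      refine setIntegral_congr_fun U.isOpen.measurableSet fun z hz => ?_
      simp only [smul_eq_mul]
      rw [hΨφ z hz, ← mul_assoc, ← real_inner_smul_right, hvec z hz]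
      congr 1
      simp only [Complex.inner, map_mul, Complex.conj_conj]
      congr 1
      ring
    · have hd : fderiv ℝ ψ z v = fderiv ℝ Ψ (φ z) (deriv φ z * v) := by
        have hc : HasFDerivAt (Ψ ∘ φ) (fderiv ℝ Ψ (φ z) ∘L (deriv φ z • (1 : ℂ →L[ℝ] ℂ))) z :=
          (c1.differentiable (by simp) (φ z)).hasFDerivAt.comp z (hφ.hasFDerivAt hz)
        have he : Ψ ∘ φ =ᶠ[𝓝 z] ψ := by
          filter_upwards [U.isOpen.mem_nhds hz] with y hy using hΨφ y hy
        rw [← he.fderiv_eq, hc.fderiv]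
        simp
      simp only [Function.comp_apply, smul_eq_mul]
      rw [hd, ← hvec z hz, map_smul, smul_eq_mul]
      ring

end IsWeakGradient

/-! ### Linearity of composition on a.e. classes. -/

namespace MeasureTheory.AEEqFun

variable {α β : Type*} [MeasurableSpace α] [MeasurableSpace β] {μ : Measure α} {ν : Measure β}
  {φ : α → β}

theorem compQuasiMeasurePreserving_add (f₁ f₂ : β →ₘ[ν] ℝ)
    (hφ : Measure.QuasiMeasurePreserving φ μ ν) :
    (f₁ + f₂).compQuasiMeasurePreserving φ hφ =
      f₁.compQuasiMeasurePreserving φ hφ + f₂.compQuasiMeasurePreserving φ hφ := by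
  induction f₁, f₂ using AEEqFun.induction_on₂ with
  | _ f₁ hf₁ f₂ hf₂ => simp only [mk_add_mk, compQuasiMeasurePreserving_mk, Pi.add_comp]

theorem compQuasiMeasurePreserving_smul (c : ℝ) (f : β →ₘ[ν] ℝ)
    (hφ : Measure.QuasiMeasurePreserving φ μ ν) :
    (c • f).compQuasiMeasurePreserving φ hφ = c • f.compQuasiMeasurePreserving φ hφ := by
  induction f using AEEqFun.induction_on with
  | _ f hf => simp only [smul_mk, compQuasiMeasurePreserving_mk, Pi.smul_comp]

end MeasureTheory.AEEqFun

/-! ### Norm estimates for the gradient. -/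

/-- At exponent 2, and only there, the factor `|φ'|` from the chain rule is raised to exactly the
power of the Jacobian. -/
theorem IsConformalMapping.eLpNorm_two_grad_comp {φ : ℂ → ℂ} {U V : Opens ℂ}
    (hφ : IsConformalMapping φ U V) (g : ℂ → ℂ) :
    eLpNorm (fun z => starRingEnd ℂ (deriv φ z) * g (φ z)) 2 (volume.restrict (U : Set ℂ)) =
      eLpNorm g 2 (volume.restrict (V : Set ℂ)) := by
  rw [eLpNorm_eq_lintegral_rpow_enorm_toReal (by simp) (by simp),
    eLpNorm_eq_lintegral_rpow_enorm_toReal (by simp) (by simp), hφ.setLIntegral_eq]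
  simp [enorm_mul, mul_pow]

/-- Hölder against the constant 1 on each side of the `L²` isometry; this is where `q ≤ 2 ≤ p`
enters. -/
theorem IsConformalMapping.eLpNorm_grad_comp_le {φ : ℂ → ℂ} {U V : Opens ℂ}
    (hφ : IsConformalMapping φ U V) {f : ℂ → ℝ} {g : ℂ → ℂ} (hfg : IsWeakGradient V f g)
    {p q : ℝ} (hp : 2 ≤ p) (hq0 : 0 ≤ q) (hq : q ≤ 2) :
    eLpNorm (fun z => starRingEnd ℂ (deriv φ z) * g (φ z)) (ENNReal.ofReal q)
        (volume.restrict (U : Set ℂ)) ≤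
      eLpNorm g (ENNReal.ofReal p) (volume.restrict (V : Set ℂ)) *
        volume (V : Set ℂ) ^ (1 / 2 - 1 / p) * volume (U : Set ℂ) ^ (1 / q - 1 / 2) := by
  have hq' : ENNReal.ofReal q ≤ 2 := by
    simpa using ENNReal.ofReal_le_ofReal hq
  have hp' : 2 ≤ ENNReal.ofReal p := by
    simpa using ENNReal.ofReal_le_ofReal hp
  have hU := eLpNorm_le_eLpNorm_mul_rpow_measure_univ hq'
    (hfg.comp_isConformalMapping hφ).locallyIntegrableOn_grad.aestronglyMeasurable
  have hV := eLpNorm_le_eLpNorm_mul_rpow_measure_univ hp'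
    hfg.locallyIntegrableOn_grad.aestronglyMeasurable
  rw [hφ.eLpNorm_two_grad_comp, Measure.restrict_apply_univ, ENNReal.toReal_ofReal hq0,
    ENNReal.toReal_ofNat] at hU
  rw [Measure.restrict_apply_univ, ENNReal.toReal_ofReal (by linarith),
    ENNReal.toReal_ofNat] at hV
  exact hU.trans (by gcongr)

/-! ### The composition operator and its norm. -/

namespace HomSobolev

variable {φ : ℂ → ℂ} {U V : Opens ℂ} {p q : ℝ}

theorem isWeakGradient_comp (hφ : IsConformalMapping φ U V) (f : HomSobolev V p) :
    IsWeakGradient U (f.1.compQuasiMeasurePreserving _ hφ.quasiMeasurePreserving)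
      (fun z => starRingEnd ℂ (deriv φ z) * grad f (φ z)) := by
  refine ((isWeakGradient_grad f).comp_isConformalMapping hφ).congr ?_
  filter_upwards [f.1.coeFn_compQuasiMeasurePreserving hφ.quasiMeasurePreserving,
    IsConformalMapping.indicator_ae_eq φ U] with z h1 h2
  rw [h1, Function.comp_apply, Function.comp_apply, h2]

theorem memLp_grad_comp (hφ : IsConformalMapping φ U V) (hU : volume (U : Set ℂ) ≠ ⊤)
    (hV : volume (V : Set ℂ) ≠ ⊤) (hp : 2 ≤ p) (hq0 : 0 < q) (hq : q ≤ 2) (f : HomSobolev V p) :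
    MemLp (fun z => starRingEnd ℂ (deriv φ z) * grad f (φ z)) (ENNReal.ofReal q)
      (volume.restrict (U : Set ℂ)) := by
  refine ⟨(isWeakGradient_comp hφ f).locallyIntegrableOn_grad.aestronglyMeasurable,
    (hφ.eLpNorm_grad_comp_le (isWeakGradient_grad f) hp hq0.le hq).trans_lt ?_⟩
  have h2p : 0 ≤ 1 / 2 - 1 / p := sub_nonneg.2 (one_div_le_one_div_of_le two_pos hp)
  have hq2 : 0 ≤ 1 / q - 1 / 2 := sub_nonneg.2 (one_div_le_one_div_of_le hq0 hq)
  exact ENNReal.mul_lt_top (ENNReal.mul_lt_top (memLp_grad f).eLpNorm_lt_top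
    (ENNReal.rpow_lt_top_of_nonneg h2p hV)) (ENNReal.rpow_lt_top_of_nonneg hq2 hU)

/-- Composition with a conformal mapping between open sets of finite measure, as a linear map of
homogeneous Sobolev spaces. -/
noncomputable def compConformal (hφ : IsConformalMapping φ U V) (hU : volume (U : Set ℂ) ≠ ⊤)
    (hV : volume (V : Set ℂ) ≠ ⊤) (hp : 2 ≤ p) (hq0 : 0 < q) (hq : q ≤ 2) :
    HomSobolev V p →ₗ[ℝ] HomSobolev U q where
  toFun f := ⟨f.1.compQuasiMeasurePreserving _ hφ.quasiMeasurePreserving, _,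
    isWeakGradient_comp hφ f, memLp_grad_comp hφ hU hV hp hq0 hq f⟩
  map_add' f₁ f₂ := Subtype.ext
    (AEEqFun.compQuasiMeasurePreserving_add f₁.1 f₂.1 hφ.quasiMeasurePreserving)
  map_smul' c f := Subtype.ext
    (AEEqFun.compQuasiMeasurePreserving_smul c f.1 hφ.quasiMeasurePreserving)

theorem compConformal_ae_eq (hφ : IsConformalMapping φ U V) (hU : volume (U : Set ℂ) ≠ ⊤)
    (hV : volume (V : Set ℂ) ≠ ⊤) (hp : 2 ≤ p) (hq0 : 0 < q) (hq : q ≤ 2) (f : HomSobolev V p)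
    {u : ℂ → ℝ} (hu : u =ᵐ[volume.restrict (V : Set ℂ)] f.1) :
    (compConformal hφ hU hV hp hq0 hq f).1 =ᵐ[volume.restrict (U : Set ℂ)] u ∘ φ := by
  filter_upwards [f.1.coeFn_compQuasiMeasurePreserving hφ.quasiMeasurePreserving,
    IsConformalMapping.indicator_ae_eq φ U,
    hφ.quasiMeasurePreserving.ae_eq_comp hu] with z h1 h2 h3
  rw [Function.comp_apply, Function.comp_apply, h2] at h3
  rw [Function.comp_apply, h3, ← h2]
  exact h1

theorem norm_compConformal_le [Fact (1 ≤ p)] [Fact (1 ≤ q)] (hφ : IsConformalMapping φ U V)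
    (hU : volume (U : Set ℂ) ≠ ⊤) (hV : volume (V : Set ℂ) ≠ ⊤) (hp : 2 ≤ p) (hq0 : 0 < q)
    (hq : q ≤ 2) (f : HomSobolev V p) :
    ‖compConformal hφ hU hV hp hq0 hq f‖ ≤
      (volume (V : Set ℂ)).toReal ^ (1 / 2 - 1 / p) *
        (volume (U : Set ℂ)).toReal ^ (1 / q - 1 / 2) * ‖f‖ := by
  have h2p : 0 ≤ 1 / 2 - 1 / p := sub_nonneg.2 (one_div_le_one_div_of_le two_pos hp)
  have hq2 : 0 ≤ 1 / q - 1 / 2 := sub_nonneg.2 (one_div_le_one_div_of_le hq0 hq)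
  have hT : ‖compConformal hφ hU hV hp hq0 hq f‖ =
      (eLpNorm (fun z => starRingEnd ℂ (deriv φ z) * grad f (φ z)) (ENNReal.ofReal q)
        (volume.restrict (U : Set ℂ))).toReal := by
    -- `grad` is an arbitrary choice; a.e. uniqueness replaces it by the explicit chain-rule
    -- gradient.
    rw [← eLpNorm_congr_ae ((isWeakGradient_grad (compConformal hφ hU hV hp hq0 hq f)).unique
      (isWeakGradient_comp hφ f))]
    exact gradNorm_eq Fact.out _
  have hf : ‖f‖ = (eLpNorm (grad f) (ENNReal.ofReal p) (volume.restrict (V : Set ℂ))).toReal :=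
    gradNorm_eq Fact.out f
  rw [hT, hf, ENNReal.toReal_rpow, ENNReal.toReal_rpow, ← ENNReal.toReal_mul,
    ← ENNReal.toReal_mul]
  refine ENNReal.toReal_mono ?_
    ((hφ.eLpNorm_grad_comp_le (isWeakGradient_grad f) hp hq0.le hq).trans_eq (by ring))
  exact ENNReal.mul_ne_top (ENNReal.mul_ne_top (ENNReal.rpow_ne_top_of_nonneg h2p hV)
    (ENNReal.rpow_ne_top_of_nonneg hq2 hU)) (memLp_grad f).eLpNorm_ne_top

end HomSobolev

theorem volume_unitDisc : volume (unitDisc : Set ℂ) = ENNReal.ofReal Real.pi := by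
  change volume (Metric.ball (0 : ℂ) 1) = _
  simp [Complex.volume_ball, ENNReal.ofReal, Real.toNNReal_of_nonneg Real.pi_nonneg]
  rfl

theorem mainTheorem7 (Ω : Opens ℂ) (hΩ : IsSimplyConnected (Ω : Set ℂ))
    (hfin : volume (Ω : Set ℂ) < ⊤)
    (φ : ℂ → ℂ) (hφ : IsConformalMapping φ unitDisc Ω)
    (p q : ℝ) [Fact (1 ≤ p)] [Fact (1 ≤ q)] (hp : 2 < p) (hq : q ≤ 2) :
    ∃ T : HomSobolev Ω p →L[ℝ] HomSobolev unitDisc q,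
      (∀ (f : HomSobolev Ω p) (u : ℂ → ℝ),
        u =ᵐ[volume.restrict (Ω : Set ℂ)] f.1 →
          (T f).1 =ᵐ[volume.restrict (unitDisc : Set ℂ)] u ∘ φ) ∧
      ‖T‖ ≤ (volume (Ω : Set ℂ)).toReal ^ ((p - 2) / (2 * p)) *
        Real.pi ^ ((2 - q) / (2 * q)) := by
  have hq0 : 0 < q := zero_lt_one.trans_le Fact.out
  have hp0 : 0 < p := two_pos.trans hp
  have hU : volume (unitDisc : Set ℂ) ≠ ⊤ := by simp [volume_unitDisc]
  have hbound : ∀ f : HomSobolev Ω p,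
      ‖HomSobolev.compConformal hφ hU hfin.ne hp.le hq0 hq f‖ ≤
        ((volume (Ω : Set ℂ)).toReal ^ ((p - 2) / (2 * p)) *
          Real.pi ^ ((2 - q) / (2 * q))) * ‖f‖ := by
    intro f
    have h := HomSobolev.norm_compConformal_le hφ hU hfin.ne hp.le hq0 hq f
    rwa [volume_unitDisc, ENNReal.toReal_ofReal Real.pi_nonneg,
      show 1 / 2 - 1 / p = (p - 2) / (2 * p) by field_simp,
      show 1 / q - 1 / 2 = (2 - q) / (2 * q) by field_simp] at h
  exact ⟨LinearMap.mkContinuous _ _ hbound,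
    fun f u hu => HomSobolev.compConformal_ae_eq hφ hU hfin.ne hp.le hq0 hq f hu,
    LinearMap.mkContinuous_norm_le _ (by positivity) hbound⟩
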